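/- There is a semidirect product $Q_{16}\rtimes_{\varphi}\mathbb{Z}/6\mathbb{Z}$ of the generalized quaternion group $Q_{16}$ of order 16 by the cyclic group $\mathbb{Z}/6\mathbb{Z}$ (for some action $\varphi:\mathbb{Z}/6\mathbb{Z}\to\mathrm{Aut}(Q_{16})$), not isomorphic to the direct product $Q_{16}\times\mathbb{Z}/6\mathbb{Z}$, with the following property. Let $K$ be any field with $\mathrm{char}(K)\neq 2,3$, let $b\in K$ be such that $\mathcal{E}_1: y^2=x^3+bx$ is an elliptic curve, and let $K_7=K(\mathcal{E}_1[7])$ be the subfield of an algebraic closure $\overline{K}$ of $K$ generated over $K$ by the coordinates of the points $P\in\mathcal{E}_1(\overline{K})$ with $7P=O$. Then $K_7/K$ is a Galois extension and $\mathrm{Gal}(K_7/K)$ is isomorphic to a subgroup of $Q_{16}\rtimes_{\varphi}\mathbb{Z}/6\mathbb{Z}$. If moreover $[K_7:K]=96$, then $\mathrm{Gal}(K_7/K)\simeq Q_{16}\rtimes_{\varphi}\mathbb{Z}/6\mathbb{Z}$. -/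

import Mathlib

/-- The Weierstrass curve `y ^ 2 = x ^ 3 + b * x` over `K`. -/
def curveE1 {K : Type*} [Field K] (b : K) : WeierstrassCurve K where
  a₁ := 0
  a₂ := 0
  a₃ := 0
  a₄ := b
  a₆ := 0

open Classical in
/-- The `m`-th division field `K(W[m])` of a Weierstrass curve `W` over `K`: the subfield of the
algebraic closure of `K` generated over `K` by the affine coordinates of all geometric points `P`
of `W` with `m • P = 0`. -/
noncomputable def divisionField {K : Type*} [Field K] (W : WeierstrassCurve K) (m : ℕ) :
    IntermediateField K (AlgebraicClosure K) :=
  IntermediateField.adjoin K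
    {z | ∃ (x y : AlgebraicClosure K)
      (h : (W.baseChange (AlgebraicClosure K)).toAffine.Nonsingular x y),
        m • WeierstrassCurve.Affine.Point.some x y h = 0 ∧ (z = x ∨ z = y)}

/-! The curve has the endomorphism `J : (x, y) ↦ (-x, i y)` with `J² = -1`. As -1 is not a square
mod 7, `J` makes the 7-torsion E[7] a vector space over 𝔽₄₉ = 𝔽₇(i). It has dimension at most 1: the
7-division polynomial allows at most 24 x-coordinates, hence at most 49 points. An automorphism σ
over K sends i to ±i, so it commutes or anticommutes with `J` and acts on E[7] by a map z ↦ c z or z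
↦ c z̄ with c ≠ 0. All these maps form a group of order 96. It is Q₁₆ ⋊ ℤ/6: Q₁₆ consists of the z ↦
c z with c⁸ = 1 and the z ↦ c z̄ with c of order 16, and ℤ/6 is generated by z ↦ 2 z̄.

K₇ is normal because automorphisms permute the torsion points. It is separable because every
K-derivation D of K₇ vanishes: invariance of dx/y makes u(P) = D x(P) / y(P) additive, so 7u = 0 on
7-torsion. In characteristic 7 the division polynomial reduces to -b¹², leaving no nonzero
7-torsion.

The kernel of the action on E[7] is the fixing subgroup of K₇, so Gal(K₇/K) embeds in the group of
order 96, and fills it when the degree is 96. -/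

/-! ### Semilinear maps of 𝔽₄₉ and the group Q₁₆ ⋊ ℤ/6. -/

/-- Conjugation on `𝔽₄₉ = 𝔽₇(i)` in the basis `1, i`. -/
def conjMatrix : Matrix (Fin 2) (Fin 2) (ZMod 7) := !![1, 0; 0, -1]

/-- Multiplication by `i` on `𝔽₄₉ = 𝔽₇(i)` in the basis `1, i`. -/
def imMatrix : Matrix (Fin 2) (Fin 2) (ZMod 7) := !![0, -1; 1, 0]

/-- Multiplication by `(2 + 3i)²`, an element of order `8` and norm `1`. -/
def rotMatrix : Matrix (Fin 2) (Fin 2) (ZMod 7) := !![2, 2; 5, 2]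

/-- The semilinear map `z ↦ (2 + 3i) z̄`, whose square is `-1`. -/
def flipMatrix : Matrix (Fin 2) (Fin 2) (ZMod 7) := !![2, 3; 3, -2]

theorem pow_zmod_val_add {M : Type*} [Monoid M] {n : ℕ} [NeZero n] {x : M} (hx : x ^ n = 1)
    (i j : ZMod n) : x ^ (i + j).val = x ^ i.val * x ^ j.val := by
  rw [ZMod.val_add, ← pow_eq_pow_mod _ hx, pow_add]

/-- The hom from `Multiplicative (ZMod n)` given by an element killed by `n`. -/
def zmodPowHom {M : Type*} [Monoid M] {n : ℕ} [NeZero n] (x : M) (hx : x ^ n = 1) :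
    Multiplicative (ZMod n) →* M where
  toFun g := x ^ (Multiplicative.toAdd g).val
  map_one' := by simp
  map_mul' g h := by simp [pow_zmod_val_add hx]

/-- The faithful representation of `Q₁₆` by semilinear maps of `𝔽₄₉`. -/
def quaternionRep : QuaternionGroup 4 →* Matrix (Fin 2) (Fin 2) (ZMod 7) where
  toFun
    | .a i => rotMatrix ^ i.val
    | .xa i => flipMatrix * rotMatrix ^ i.val
  map_one' := by decide
  map_mul' := by decide +kernel

/-- The automorphism of `Q₁₆` induced by conjugation on `𝔽₄₉`. -/
def conjAut : MulAut (QuaternionGroup 4) where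
  toFun
    | .a i => .a (-i)
    -- The shift by 3 comes from Frobenius: the conjugate of 2 + 3i is (2 + 3i)⁷ = (2 + 3i) · ((2 +
    -- 3i)²)³, and moving the cube of the rotation to the right of z̄ inverts it.
    | .xa i => .xa (-i - 3)
  invFun
    | .a i => .a (-i)
    | .xa i => .xa (-i - 3)
  left_inv := by rintro (i | i) <;> simp
  right_inv := by rintro (i | i) <;> simp
  map_mul' := by decide +kernel

theorem conjAut_pow_six : conjAut ^ 6 = 1 := by
  ext q
  revert q
  decide +kernel

/-- The action of `ℤ/6` on `Q₁₆` through `conjAut`. -/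
def semilinearAction : Multiplicative (ZMod 6) →* MulAut (QuaternionGroup 4) :=
  zmodPowHom conjAut conjAut_pow_six

/-- The generator of `ℤ/6` acts on `𝔽₄₉` by `z ↦ 2 z̄`. -/
def cyclicRep : Multiplicative (ZMod 6) →* Matrix (Fin 2) (Fin 2) (ZMod 7) :=
  zmodPowHom (2 • conjMatrix) (by decide +kernel)

theorem cyclicRep_mul_quaternionRep (g : Multiplicative (ZMod 6)) (q : QuaternionGroup 4) :
    cyclicRep g * quaternionRep q = quaternionRep (semilinearAction g q) * cyclicRep g := by
  revert g q
  decide +kernel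

/-- The representation of `Q₁₆ ⋊ ℤ/6` by semilinear maps of `𝔽₄₉`. -/
def semilinearRep : QuaternionGroup 4 ⋊[semilinearAction] Multiplicative (ZMod 6) →*
    Matrix (Fin 2) (Fin 2) (ZMod 7) where
  toFun s := quaternionRep s.left * cyclicRep s.right
  map_one' := by simp
  map_mul' s t := by
    simp only [SemidirectProduct.mul_left, SemidirectProduct.mul_right, map_mul, mul_assoc]
    rw [← mul_assoc (quaternionRep _) (cyclicRep s.right), ← cyclicRep_mul_quaternionRep]
    simp only [mul_assoc]

theorem semilinearRep_injective : Function.Injective semilinearRep := by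
  rw [injective_iff_map_eq_one]
  rintro ⟨q, g⟩ h
  have : ∀ (q : QuaternionGroup 4) (g : Multiplicative (ZMod 6)),
    quaternionRep q * cyclicRep g = 1 → q = 1 ∧ g = 1 := by decide +kernel
  obtain ⟨rfl, rfl⟩ := this q g h
  rfl

/-- Such a matrix is determined by its first column (m, n): it is z ↦ (m + n i) z or z ↦ (m + n i)
z̄. A finite check finds all of these in the image. -/
theorem exists_semilinearRep_eq {M : Matrix (Fin 2) (Fin 2) (ZMod 7)} (hM : M ≠ 0)
    (h : M * imMatrix = imMatrix * M ∨ M * imMatrix = -(imMatrix * M)) :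
    ∃ s, semilinearRep s = M := by
  have key : ∀ m n : ZMod 7, ¬(m = 0 ∧ n = 0) →
      (∃ q g, quaternionRep q * cyclicRep g = !![m, -n; n, m]) ∧
      (∃ q g, quaternionRep q * cyclicRep g = !![m, n; n, -m]) := by decide +kernel
  have h0 : ¬(M 0 0 = 0 ∧ M 1 0 = 0) := by
    rintro ⟨h1, h2⟩
    apply hM
    have : M 0 1 = 0 ∧ M 1 1 = 0 := by
      rcases h with h | h <;>
      · have h3 := congr_fun (congr_fun h 0) 0
        have h4 := congr_fun (congr_fun h 1) 0
        simp [imMatrix, Matrix.mul_apply, Matrix.vecMul, dotProduct, Fin.sum_univ_two, h1, h2] at h3 h4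
        exact ⟨h3, h4⟩
    ext i j
    fin_cases i <;> fin_cases j <;> simp [h1, h2, this.1, this.2]
  rcases h with h | h
  · obtain ⟨q, g, hs⟩ := (key _ _ h0).1
    refine ⟨⟨q, g⟩, hs.trans ?_⟩
    have h3 := congr_fun (congr_fun h 0) 0
    have h4 := congr_fun (congr_fun h 1) 0
    simp [imMatrix, Matrix.mul_apply, Fin.sum_univ_two] at h3 h4
    ext i j
    fin_cases i <;> fin_cases j <;> simp [h3, h4]
  · obtain ⟨q, g, hs⟩ := (key _ _ h0).2
    refine ⟨⟨q, g⟩, hs.trans ?_⟩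
    have h3 := congr_fun (congr_fun h 0) 0
    have h4 := congr_fun (congr_fun h 1) 0
    simp [imMatrix, Matrix.mul_apply, Matrix.vecMul, dotProduct, Fin.sum_univ_two] at h3 h4
    ext i j
    fin_cases i <;> fin_cases j <;> simp [h3, h4]

/-- Exponents differ: the direct product is killed by 24, while the semidirect product has an
element of order 16. -/
theorem isEmpty_mulEquiv_prod :
    IsEmpty ((QuaternionGroup 4 ⋊[semilinearAction] Multiplicative (ZMod 6)) ≃*
      (QuaternionGroup 4 × Multiplicative (ZMod 6))) := by
  refine ⟨fun e ↦ ?_⟩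
  -- Since 2³ = 1 mod 7 and the two conjugations cancel, `s` acts as multiplication by 2 + 3i, of
  -- order 16.
  let s : QuaternionGroup 4 ⋊[semilinearAction] Multiplicative (ZMod 6) :=
    ⟨.xa 0, Multiplicative.ofAdd 3⟩
  have hq : ∀ q : QuaternionGroup 4, q ^ 24 = 1 := by decide +kernel
  have hg : ∀ g : Multiplicative (ZMod 6), g ^ 24 = 1 := by decide +kernel
  have h1 : e s ^ 24 = 1 := Prod.ext (hq _) (hg _)
  have h2 : s ^ 24 = 1 := e.injective (by rw [map_pow, h1, map_one])
  have h3 : semilinearRep s ^ 24 = 1 := by rw [← map_pow, h2, map_one]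
  have h4 : quaternionRep (.xa 0) * cyclicRep (Multiplicative.ofAdd 3) =
    !![2, -3; 3, 2] := by decide +kernel
  change (quaternionRep (.xa 0) * cyclicRep (Multiplicative.ofAdd 3)) ^ 24 = 1 at h3
  rw [h4] at h3
  revert h3
  decide +kernel

theorem card_semidirectProduct :
    Nat.card (QuaternionGroup 4 ⋊[semilinearAction] Multiplicative (ZMod 6)) = 96 := by
  rw [SemidirectProduct.card]
  simp [Nat.card_eq_fintype_card, QuaternionGroup.card]

instance fact_prime_seven : Fact (Nat.Prime 7) := ⟨by norm_num⟩

/-! ### 𝔽₇-spaces of at most 49 elements with a square root of -1. -/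

theorem linearIndependent_pair_of_sq_eq_neg_one {V : Type*} [AddCommGroup V] [Module (ZMod 7) V]
    (J : Module.End (ZMod 7) V) (hJ : J * J = -1) {v : V} (hv : v ≠ 0) :
    LinearIndependent (ZMod 7) ![v, J v] := by
  rw [LinearIndependent.pair_iff' hv]
  intro a ha
  have h1 : J (J v) = -v := by simpa using LinearMap.congr_fun hJ v
  rw [← ha, map_smul, ← ha, smul_smul] at h1
  have h2 : (a * a + 1) • v = 0 := by rw [add_smul, h1, one_smul, neg_add_cancel]
  have h3 : ∀ a : ZMod 7, a * a + 1 ≠ 0 := by decide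
  exact (smul_eq_zero.mp h2).elim (h3 a) hv

theorem exists_hom_semidirectProduct {V G : Type*} [AddCommGroup V] [Module (ZMod 7) V] [Finite V]
    [Group G] (hV : Nat.card V ≤ 49) (J : Module.End (ZMod 7) V) (hJ : J * J = -1)
    (ρ : G →* Module.End (ZMod 7) V) (hρ : ∀ g, ρ g * J = J * ρ g ∨ ρ g * J = -(J * ρ g)) :
    ∃ f : G →* QuaternionGroup 4 ⋊[semilinearAction] Multiplicative (ZMod 6),
      ∀ g, f g = 1 ↔ ρ g = 1 := by
  -- Only an upper bound on the size is known; the zero space does occur, for the 7-torsion in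
  -- characteristic 7.
  rcases subsingleton_or_nontrivial V with hs | hs
  · exact ⟨1, fun g ↦ by simp [Subsingleton.elim (ρ g) 1]⟩
  obtain ⟨v, hv⟩ := exists_ne (0 : V)
  have hli := linearIndependent_pair_of_sq_eq_neg_one J hJ hv
  have hrank : Module.finrank (ZMod 7) V = 2 := by
    refine le_antisymm ?_ (by simpa using hli.fintype_card_le_finrank)
    rw [Module.natCard_eq_pow_finrank (K := ZMod 7), Nat.card_zmod] at hV
    exact (Nat.pow_le_pow_iff_right (by norm_num : 1 < 7)).mp (hV.trans_eq (by norm_num : 49 = 7 ^ 2))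
  let B := basisOfLinearIndependentOfCardEqFinrank hli (by simp [hrank])
  have hB0 : B 0 = v := by simp [B]
  have hB1 : B 1 = J v := by simp [B]
  let e := LinearMap.toMatrixAlgEquiv B
  have heJ : e J = imMatrix := by
    have h1 : J (J v) = -v := by simpa using LinearMap.congr_fun hJ v
    rw [← hB1, ← hB0] at h1
    ext i j
    rw [LinearMap.toMatrixAlgEquiv_apply]
    fin_cases j
    · simp only [Fin.zero_eta, hB0, ← hB1, B.repr_self]
      fin_cases i <;> simp [imMatrix]
    · simp only [Fin.mk_one, h1, map_neg, B.repr_self]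
      fin_cases i <;> simp [imMatrix]
  have hex (g : G) : ∃ s, semilinearRep s = e (ρ g) := by
    apply exists_semilinearRep_eq
    · rw [Ne, EmbeddingLike.map_eq_zero_iff]
      intro h
      have := map_mul ρ g g⁻¹
      rw [mul_inv_cancel, map_one, h, zero_mul] at this
      exact one_ne_zero this
    · rw [← heJ, ← map_mul, ← map_mul, ← map_neg, e.injective.eq_iff, e.injective.eq_iff]
      exact hρ g
  choose s hs using hex
  refine ⟨MonoidHom.mk' s fun g h ↦ semilinearRep_injective ?_, fun g ↦ ?_⟩
  · rw [hs, map_mul, map_mul, map_mul, hs, hs]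
  · rw [MonoidHom.mk'_apply, ← semilinearRep_injective.eq_iff, hs, map_one,
      EmbeddingLike.map_eq_one_iff]

/-! ### Chord and tangent formulas and 7-torsion points. -/

section CurveE1

open WeierstrassCurve.Affine WeierstrassCurve.Affine.Point

variable {F : Type*} [Field F] {W : WeierstrassCurve.Affine F} {b : F}

theorem curveE1_negY (hW : W = curveE1 b) (x y : F) : W.negY x y = -y := by
  subst hW
  simp [WeierstrassCurve.Affine.negY, curveE1]

theorem curveE1_equation_iff (hW : W = curveE1 b) (x y : F) :
    W.Equation x y ↔ y ^ 2 = x ^ 3 + b * x := by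
  subst hW
  simp [WeierstrassCurve.Affine.equation_iff, curveE1]

theorem curveE1_nonsingular_iff (hW : W = curveE1 b) (x y : F) :
    W.Nonsingular x y ↔ y ^ 2 = x ^ 3 + b * x ∧ (3 * x ^ 2 + b ≠ 0 ∨ 2 * y ≠ 0) := by
  rw [WeierstrassCurve.Affine.nonsingular_iff', curveE1_equation_iff hW]
  subst hW
  refine and_congr_right fun _ ↦ or_congr ?_ (by simp [curveE1])
  simp only [curveE1, zero_mul, mul_zero, add_zero, zero_sub, neg_ne_zero]

theorem curveE1_Y_ne_zero_of_add_self_ne_zero [DecidableEq F] (hW : W = curveE1 b) {x y : F}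
    (h : W.Nonsingular x y) (h2 : Point.some x y h + Point.some x y h ≠ 0) : y ≠ 0 := by
  rintro rfl
  exact h2 (add_self_of_Y_eq (by rw [curveE1_negY hW, _root_.neg_zero]))

theorem curveE1_add_self [DecidableEq F] (hW : W = curveE1 b) (two : (2 : F) ≠ 0) {x y : F}
    (h : W.Nonsingular x y) (hy : y ≠ 0) :
    ∃ ℓ x' y', ∃ h' : W.Nonsingular x' y',
      Point.some x y h + Point.some x y h = Point.some x' y' h' ∧
      2 * y * ℓ = 3 * x ^ 2 + b ∧ x' = ℓ ^ 2 - 2 * x ∧ y' = -(ℓ * (x' - x) + y) := by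
  have hne : y ≠ W.negY x y := by
    rw [curveE1_negY hW, ne_eq, eq_neg_iff_add_eq_zero, ← two_mul]
    exact mul_ne_zero two hy
  refine ⟨W.slope x x y y, _, _, _, add_self_of_Y_ne hne, ?_, ?_, ?_⟩
  · rw [slope_of_Y_ne rfl hne, curveE1_negY hW]
    subst hW
    have h3 : y - -y ≠ 0 := by rw [sub_neg_eq_add, ← two_mul]; exact mul_ne_zero two hy
    rw [mul_div_assoc', div_eq_iff h3]
    simp only [curveE1]
    ring
  · subst hW
    simp only [WeierstrassCurve.Affine.addX, curveE1]
    ring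
  · rw [WeierstrassCurve.Affine.addY, curveE1_negY hW, WeierstrassCurve.Affine.negAddY]

theorem curveE1_add_of_X_ne [DecidableEq F] (hW : W = curveE1 b) {x₁ y₁ x₂ y₂ : F}
    (h₁ : W.Nonsingular x₁ y₁) (h₂ : W.Nonsingular x₂ y₂) (hx : x₁ ≠ x₂) :
    ∃ ℓ x' y', ∃ h' : W.Nonsingular x' y',
      Point.some x₁ y₁ h₁ + Point.some x₂ y₂ h₂ = Point.some x' y' h' ∧
      ℓ * (x₂ - x₁) = y₂ - y₁ ∧ x' = ℓ ^ 2 - x₁ - x₂ ∧ y' = -(ℓ * (x' - x₁) + y₁) := by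
  refine ⟨W.slope x₁ x₂ y₁ y₂, _, _, _, add_of_X_ne hx, ?_, ?_, ?_⟩
  · rw [slope_of_X_ne hx, div_mul_eq_mul_div, div_eq_iff (sub_ne_zero.mpr hx)]
    ring
  · subst hW
    simp only [WeierstrassCurve.Affine.addX, curveE1]
    ring
  · rw [WeierstrassCurve.Affine.addY, curveE1_negY hW, WeierstrassCurve.Affine.negAddY]

/-- The coordinates of `2P`, `3P` and of `4P = -3P` for a nonzero `7`-torsion point `P`. -/
theorem curveE1_seven_torsion_multiples [DecidableEq F] (hW : W = curveE1 b) (two : (2 : F) ≠ 0)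
    {x y : F} (h : W.Nonsingular x y) (h7 : 7 • Point.some x y h = 0) :
    ∃ ℓ₁ ℓ₂ ℓ₃ x₂ y₂ x₃ y₃, y ≠ 0 ∧ y₂ ≠ 0 ∧ y₃ ≠ 0 ∧ x ≠ x₂ ∧
      y₂ ^ 2 = x₂ ^ 3 + b * x₂ ∧
      (2 * y * ℓ₁ = 3 * x ^ 2 + b ∧ x₂ = ℓ₁ ^ 2 - 2 * x ∧ y₂ = -(ℓ₁ * (x₂ - x) + y)) ∧
      (ℓ₂ * (x₂ - x) = y₂ - y ∧ x₃ = ℓ₂ ^ 2 - x - x₂ ∧ y₃ = -(ℓ₂ * (x₃ - x) + y)) ∧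
      (2 * y₂ * ℓ₃ = 3 * x₂ ^ 2 + b ∧ x₃ = ℓ₃ ^ 2 - 2 * x₂ ∧ -y₃ = -(ℓ₃ * (x₃ - x₂) + y₂)) := by
  set P := Point.some x y h with hP
  have hP0 : P ≠ 0 := some_ne_zero h
  have mul_ne (n : ℕ) (hn : n.Coprime 7) : n • P ≠ 0 := by
    intro hnP
    have h1 := addOrderOf_dvd_of_nsmul_eq_zero hnP
    have h2 := addOrderOf_dvd_of_nsmul_eq_zero h7
    exact hP0 (AddMonoid.addOrderOf_eq_one_iff.mp (Nat.dvd_one.mp (hn ▸ Nat.dvd_gcd h1 h2)))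
  have hy : y ≠ 0 := curveE1_Y_ne_zero_of_add_self_ne_zero hW h (two_nsmul P ▸ mul_ne 2 (by norm_num))
  obtain ⟨ℓ₁, x₂, y₂, h₂, hP₂, e₁⟩ := curveE1_add_self hW two h hy
  rw [← hP, ← two_nsmul] at hP₂
  have hy₂ : y₂ ≠ 0 := curveE1_Y_ne_zero_of_add_self_ne_zero hW h₂ (by
    rw [← hP₂, ← two_nsmul, ← mul_nsmul]
    exact mul_ne 4 (by norm_num))
  have hx : x ≠ x₂ := by
    intro hx
    rcases (X_eq_iff (h₁ := h) (h₂ := h₂)).mp hx with hx | hx <;> rw [← hP, ← hP₂] at hx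
    · exact hP0 (by simpa only [two_nsmul, left_eq_add] using hx)
    · refine mul_ne 3 (by norm_num) ?_
      rw [succ_nsmul, add_comm]
      exact eq_neg_iff_add_eq_zero.mp hx
  obtain ⟨ℓ₂, x₃, y₃, h₃, hP₃, e₂⟩ := curveE1_add_of_X_ne hW h h₂ hx
  rw [← hP, ← hP₂, ← succ_nsmul'] at hP₃
  have hy₃ : y₃ ≠ 0 := curveE1_Y_ne_zero_of_add_self_ne_zero hW h₃ (by
    rw [← hP₃, ← two_nsmul, ← mul_nsmul]
    exact mul_ne 6 (by norm_num))
  obtain ⟨ℓ₃, x₄, y₄, h₄, hP₄, e₃⟩ := curveE1_add_self hW two h₂ hy₂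
  have h43 : Point.some x₄ y₄ h₄ = -Point.some x₃ y₃ h₃ := by
    rw [← hP₃, ← hP₄, ← hP₂, ← two_nsmul, ← mul_nsmul, eq_neg_iff_add_eq_zero, ← add_nsmul]
    exact h7
  rw [neg_some, Point.some.injEq, curveE1_negY hW] at h43
  obtain ⟨rfl, rfl⟩ := h43
  exact ⟨ℓ₁, ℓ₂, ℓ₃, x₂, y₂, x₄, y₃, hy, hy₂, hy₃, hx, (curveE1_equation_iff hW _ _).mp h₂.1,
    e₁, e₂, e₃⟩

/-- A nonzero `7`-torsion point has its `x`-coordinate among the roots of the `7`-division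
polynomial. -/
theorem curveE1_seven_torsion_eval [DecidableEq F] (hW : W = curveE1 b) (two : (2 : F) ≠ 0)
    {x y : F} (h : W.Nonsingular x y) (h7 : 7 • Point.some x y h = 0) :
    7 * (x ^ 24 + 44 * b * x ^ 22 - 422 * b ^ 2 * x ^ 20 - 2836 * b ^ 3 * x ^ 18
      - 5033 * b ^ 4 * x ^ 16 - 11752 * b ^ 5 * x ^ 14 - 15988 * b ^ 6 * x ^ 12
      - 6024 * b ^ 7 * x ^ 10 + 2239 * b ^ 8 * x ^ 8 + 2108 * b ^ 9 * x ^ 6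
      + 186 * b ^ 10 * x ^ 4 + 28 * b ^ 11 * x ^ 2) - b ^ 12 = 0 := by
  have hE := (curveE1_equation_iff hW x y).mp h.1
  obtain ⟨ℓ₁, ℓ₂, ℓ₃, x₂, y₂, x₃, y₃, hy, hy₂, -, hx, hE₂, ⟨a₁, a₂, a₃⟩, ⟨c₁, c₂, -⟩,
    ⟨d₁, d₂, -⟩⟩ := curveE1_seven_torsion_multiples hW two h h7
  obtain ⟨N, hN⟩ : ∃ N, N = y ^ 2 := ⟨_, rfl⟩
  have hN0 : N ≠ 0 := hN ▸ pow_ne_zero 2 hy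
  have hNx : N = x ^ 3 + b * x := hN.trans hE
  have four : (4 : F) ≠ 0 := by convert mul_ne_zero two two using 1; norm_num
  have hx₂ : 4 * N * x₂ = (x ^ 2 - b) ^ 2 := by
    have : 4 * N * x₂ = (2 * y * ℓ₁) ^ 2 - 8 * x * N := by rw [a₂, hN]; ring
    rw [this, a₁, hNx]; ring
  -- In terms of division polynomials, Q = ψ₄ / (4y) and T = ψ₃. They give y(2P) = Q / (8y³) and
  -- x(3P) = x - 8y²Q / T².
  obtain ⟨Q, hQ⟩ : ∃ Q, Q = x ^ 6 + 5 * b * x ^ 4 - 5 * b ^ 2 * x ^ 2 - b ^ 3 := ⟨_, rfl⟩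
  obtain ⟨T, hT⟩ : ∃ T, T = 3 * x ^ 4 + 6 * b * x ^ 2 - b ^ 2 := ⟨_, rfl⟩
  have hy₂' : 8 * N * (y * y₂) = Q := by
    have : 8 * N * (y * y₂) = -((2 * y * ℓ₁) * (4 * N * x₂ - 4 * N * x) + 8 * N * N) := by
      rw [a₃, hN]; ring
    rw [this, a₁, hx₂, hNx, hQ]; ring
  have hT₂ : 4 * N * (x₂ - x) = -T := by rw [mul_sub, hx₂, hNx, hT]; ring
  have hℓ₂ : 2 * T * (y * ℓ₂) = 8 * N ^ 2 - Q := by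
    have : -2 * T * (y * ℓ₂) = 8 * N * y * (ℓ₂ * (x₂ - x)) := by
      linear_combination -2 * y * ℓ₂ * hT₂
    rw [c₁] at this
    linear_combination -this - hy₂' - 8 * N * hN
  have hx₃ : T ^ 2 * x₃ = T ^ 2 * x - 8 * N * Q := by
    apply mul_left_cancel₀ (mul_ne_zero four hN0)
    have : 4 * N * (T ^ 2 * x₃) = (2 * T * (y * ℓ₂)) ^ 2 - 4 * N * T ^ 2 * x
        - T ^ 2 * (4 * N * x₂) := by rw [c₂, hN]; ring
    rw [this, hℓ₂, hx₂, hNx, hQ, hT]; ring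
  have hx₄ : 4 * y₂ ^ 2 * x₃ = (x₂ ^ 2 - b) ^ 2 := by
    have : 4 * y₂ ^ 2 * x₃ = (2 * y₂ * ℓ₃) ^ 2 - 8 * x₂ * y₂ ^ 2 := by rw [d₂]; ring
    rw [this, d₁, hE₂]; ring
  have hx₄' : 16 * N * Q ^ 2 * x₃ = ((x ^ 2 - b) ^ 4 - 16 * b * N ^ 2) ^ 2 := by
    rw [← hy₂']
    have h1 : (x ^ 2 - b) ^ 4 = (4 * N * x₂) ^ 2 := by rw [hx₂]; ring
    rw [h1]
    linear_combination 256 * N ^ 4 * hx₄ - 1024 * N ^ 3 * y₂ ^ 2 * x₃ * hN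
  -- This is x(3P) = x(4P) with denominators cleared. Its two sides differ by exactly ψ₇, with
  -- leading coefficient 144 - 128 - 9 = 7.
  have key : 16 * N * Q ^ 2 * (T ^ 2 * x - 8 * N * Q)
      = T ^ 2 * ((x ^ 2 - b) ^ 4 - 16 * b * N ^ 2) ^ 2 := by
    rw [← hx₃, ← hx₄']; ring
  rw [hNx, hQ, hT] at key
  linear_combination key

/-- The map `P ↦ D x(P) / y(P)` is additive, so it vanishes on `7`-torsion. -/
theorem curveE1_seven_torsion_derivation_eq_zero {K : Type*} [Field K] [Algebra K F]
    [DecidableEq F] (hW : W = curveE1 b) (two : (2 : F) ≠ 0) (seven : (7 : F) ≠ 0)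
    (D : Derivation K F F) (hb : D b = 0) {x y : F} (h : W.Nonsingular x y)
    (h7 : 7 • Point.some x y h = 0) : D x = 0 ∧ D y = 0 := by
  have hE := (curveE1_equation_iff hW x y).mp h.1
  obtain ⟨ℓ₁, ℓ₂, ℓ₃, x₂, y₂, x₃, y₃, hy, hy₂, hy₃, hx, hE₂, ⟨a₁, a₂, a₃⟩, ⟨c₁, c₂, c₃⟩,
    ⟨d₁, d₂, d₃⟩⟩ := curveE1_seven_torsion_multiples hW two h h7
  have D_equation {x y : F} (hE : y ^ 2 = x ^ 3 + b * x) :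
      2 * y * D y = (3 * x ^ 2 + b) * D x := by
    have := congr_arg D hE
    simp only [Derivation.leibniz_pow, map_add, Derivation.leibniz, hb, smul_eq_mul,
      nsmul_eq_mul] at this
    push_cast at this
    linear_combination this
  have D_double {x y ℓ x' y' : F} (hE : y ^ 2 = x ^ 3 + b * x) (hy : y ≠ 0)
      (h1 : 2 * y * ℓ = 3 * x ^ 2 + b) (h2 : x' = ℓ ^ 2 - 2 * x)
      (h3 : y' = -(ℓ * (x' - x) + y)) : y * D x' = 2 * y' * D x := by
    have hDy : D y = ℓ * D x := by
      apply mul_left_cancel₀ (mul_ne_zero two hy)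
      rw [D_equation hE, ← h1]; ring
    have hDℓ : y * D ℓ = 3 * x * D x - ℓ * D y := by
      have := congr_arg D h1
      apply mul_left_cancel₀ two
      have e2 : D (2 : F) = 0 := by exact_mod_cast D.map_natCast 2
      have e3 : D (3 : F) = 0 := by exact_mod_cast D.map_natCast 3
      simp only [Derivation.leibniz_pow, map_add, Derivation.leibniz, hb, smul_eq_mul,
        nsmul_eq_mul, e2, e3] at this
      push_cast at this
      linear_combination this
    have hDx : D x' = 2 * ℓ * D ℓ - 2 * D x := by
      have e2 : D (2 : F) = 0 := by exact_mod_cast D.map_natCast 2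
      rw [h2]
      simp only [Derivation.leibniz_pow, map_sub, Derivation.leibniz, smul_eq_mul,
        nsmul_eq_mul, e2]
      push_cast
      ring
    rw [hDx, h3, h2]
    linear_combination 2 * ℓ * hDℓ - 2 * ℓ ^ 2 * hDy
  have D_add {x₁ y₁ x₂ y₂ ℓ x' y' u₁ u₂ : F} (hE₁ : y₁ ^ 2 = x₁ ^ 3 + b * x₁)
      (hE₂ : y₂ ^ 2 = x₂ ^ 3 + b * x₂) (hy₁ : y₁ ≠ 0) (hy₂ : y₂ ≠ 0) (hx : x₁ ≠ x₂)
      (h1 : ℓ * (x₂ - x₁) = y₂ - y₁) (h2 : x' = ℓ ^ 2 - x₁ - x₂)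
      (h3 : y' = -(ℓ * (x' - x₁) + y₁)) (hu₁ : D x₁ = y₁ * u₁) (hu₂ : D x₂ = y₂ * u₂) :
      D x' = y' * (u₁ + u₂) := by
    have hd : x₂ - x₁ ≠ 0 := sub_ne_zero.mpr hx.symm
    have hDy₁ : 2 * D y₁ = (3 * x₁ ^ 2 + b) * u₁ := by
      apply mul_left_cancel₀ hy₁
      have := D_equation hE₁
      rw [hu₁] at this
      linear_combination this
    have hDy₂ : 2 * D y₂ = (3 * x₂ ^ 2 + b) * u₂ := by
      apply mul_left_cancel₀ hy₂
      have := D_equation hE₂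
      rw [hu₂] at this
      linear_combination this
    have hDℓ : (x₂ - x₁) * D ℓ = D y₂ - D y₁ - ℓ * (y₂ * u₂ - y₁ * u₁) := by
      have := congr_arg D h1
      simp only [map_sub, Derivation.leibniz, smul_eq_mul, hu₁, hu₂] at this
      linear_combination this
    have hDx : D x' = 2 * ℓ * D ℓ - y₁ * u₁ - y₂ * u₂ := by
      rw [h2]
      simp only [Derivation.leibniz_pow, map_sub, smul_eq_mul, nsmul_eq_mul, hu₁, hu₂]
      push_cast
      ring
    -- `hB₁` and `hB₂` are the derivatives at x₁ and x₂ of x³ + b x - (ℓ(x - x₁) + y₁)² = (x - x₁)(x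
    -- - x₂)(x - x'), whose roots are the intersections with the chord.
    have hB₁ : -(3 * x₁ ^ 2 + b) + 2 * ℓ * y₁ + (x₂ - x₁) * (ℓ ^ 2 - 2 * x₁ - x₂) = 0 := by
      apply mul_left_cancel₀ hd
      linear_combination (2 * y₁ + ℓ * (x₂ - x₁) + y₂ - y₁) * h1 + hE₂ - hE₁
    have hB₂ : 3 * x₂ ^ 2 + b - 2 * ℓ * y₂ + (x₂ - x₁) * (ℓ ^ 2 - x₁ - 2 * x₂) = 0 := by
      apply mul_left_cancel₀ hd
      linear_combination (-2 * y₂ + ℓ * (x₂ - x₁) + y₂ - y₁) * h1 - hE₂ + hE₁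
    apply mul_left_cancel₀ hd
    rw [hDx, h3, h2]
    linear_combination 2 * ℓ * hDℓ + ℓ * hDy₂ - ℓ * hDy₁ + ℓ * u₁ * hB₁ + ℓ * u₂ * hB₂
      + u₂ * (x₂ - x₁) * h1
  obtain ⟨u, hu⟩ : ∃ u, D x = y * u := ⟨D x / y, by field_simp⟩
  have hu₂ : D x₂ = y₂ * (2 * u) := by
    apply mul_left_cancel₀ hy
    rw [D_double hE hy a₁ a₂ a₃, hu]; ring
  have hu₃ := D_add hE hE₂ hy hy₂ hx c₁ c₂ c₃ hu hu₂
  have hu₄ : D x₃ = -y₃ * (4 * u) := by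
    apply mul_left_cancel₀ hy₂
    rw [D_double hE₂ hy₂ d₁ d₂ d₃, hu₂]; ring
  -- u(3P) = 3u and u(4P) = 4u, while 4P = -3P forces u(4P) = -3u.
  have hu0 : u = 0 := by
    apply mul_left_cancel₀ (mul_ne_zero seven hy₃)
    linear_combination hu₄ - hu₃
  have hDx : D x = 0 := by rw [hu, hu0, mul_zero]
  refine ⟨hDx, mul_left_cancel₀ (mul_ne_zero two hy) ?_⟩
  rw [D_equation hE, hDx, mul_zero, mul_zero]

/-! ### Complex multiplication by i. -/

/-- The endomorphism `(x, y) ↦ (-x, i y)`, where `i ^ 2 = -1`. -/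
def curveE1IMul [DecidableEq F] (hW : W = curveE1 b) {i : F} (hi : i ^ 2 = -1) :
    W.Point →+ W.Point where
  toFun
    | 0 => 0
    | .some x y h => .some (-x) (i * y) (by
        rw [curveE1_nonsingular_iff hW] at h ⊢
        have hi0 : i ≠ 0 := by rintro rfl; simp at hi
        refine ⟨by linear_combination y ^ 2 * hi - h.1, h.2.imp (by simp) fun h2 h3 ↦ h2 ?_⟩
        apply mul_left_cancel₀ hi0
        linear_combination h3)
  map_zero' := rfl
  map_add' := by
    have hi0 : i ≠ 0 := by rintro rfl; simp at hi
    rintro (_ | ⟨x₁, y₁, h₁⟩) (_ | ⟨x₂, y₂, h₂⟩)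
    · rfl
    · exact (zero_add _).symm
    · exact (add_zero _).symm
    by_cases hxy : x₁ = x₂ ∧ y₁ = W.negY x₂ y₂
    · rw [add_of_Y_eq hxy.1 hxy.2]
      refine (add_of_Y_eq (by rw [hxy.1]) ?_).symm
      rw [hxy.2, curveE1_negY hW, curveE1_negY hW, mul_neg]
    · have hxy' : ¬(-x₁ = -x₂ ∧ i * y₁ = W.negY (-x₂) (i * y₂)) := by
        rw [curveE1_negY hW] at hxy ⊢
        rintro ⟨e1, e2⟩
        exact hxy ⟨neg_injective e1, mul_left_cancel₀ hi0 (by rw [e2, mul_neg])⟩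
      -- The map scales x by -1 and y by i, so it scales slopes by -i.
      have hs : W.slope (-x₁) (-x₂) (i * y₁) (i * y₂) = -i * W.slope x₁ x₂ y₁ y₂ := by
        by_cases hx : x₁ = x₂
        · have hy : y₁ ≠ W.negY x₂ y₂ := fun hy ↦ hxy ⟨hx, hy⟩
          have hy' : i * y₁ ≠ W.negY (-x₂) (i * y₂) := fun hy ↦ hxy' ⟨by rw [hx], hy⟩
          rw [slope_of_Y_ne hx hy, slope_of_Y_ne (by rw [hx]) hy', curveE1_negY hW,
            curveE1_negY hW]
          have : W.a₁ = 0 ∧ W.a₂ = 0 := by subst hW; simp [curveE1]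
          rw [this.1, this.2, show i * y₁ - -(i * y₁) = i * (y₁ - -y₁) by ring,
            ← div_div, mul_div_assoc']
          congr 1
          rw [div_eq_iff hi0]
          linear_combination (3 * x₁ ^ 2 + W.a₄) * hi
        · rw [slope_of_X_ne hx, slope_of_X_ne (fun e ↦ hx (neg_injective e)),
            show -x₁ - -x₂ = -(x₁ - x₂) by ring, div_neg]
          ring
      rw [add_some hxy]
      refine Eq.trans ?_ (add_some hxy').symm
      have hX : W.addX (-x₁) (-x₂) (W.slope (-x₁) (-x₂) (i * y₁) (i * y₂))
          = -W.addX x₁ x₂ (W.slope x₁ x₂ y₁ y₂) := by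
        rw [hs, addX, addX]
        have : W.a₁ = 0 ∧ W.a₂ = 0 := by subst hW; simp [curveE1]
        rw [this.1, this.2]
        linear_combination (W.slope x₁ x₂ y₁ y₂) ^ 2 * hi
      have hY : W.addY (-x₁) (-x₂) (i * y₁) (W.slope (-x₁) (-x₂) (i * y₁) (i * y₂))
          = i * W.addY x₁ x₂ y₁ (W.slope x₁ x₂ y₁ y₂) := by
        rw [addY, addY, negAddY, negAddY, hX, hs, curveE1_negY hW, curveE1_negY hW]
        ring
      simp only [Point.some.injEq]
      exact ⟨hX.symm, hY.symm⟩

theorem curveE1IMul_curveE1IMul [DecidableEq F] (hW : W = curveE1 b) {i : F} (hi : i ^ 2 = -1)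
    (P : W.Point) : curveE1IMul hW hi (curveE1IMul hW hi P) = -P := by
  rcases P with _ | ⟨x, y, h⟩
  · rfl
  · refine (Point.some.injEq ..).mpr ⟨neg_neg x, ?_⟩
    rw [curveE1_negY hW]
    linear_combination y * hi

end CurveE1

/-! ### Counting the 7-torsion. -/

open Polynomial in
/-- The `7`-division polynomial of `y ^ 2 = x ^ 3 + b * x`. -/
noncomputable def curveE1DivisionPolynomialSeven {F : Type*} [Field F] (b : F) : F[X] :=
  7 * (X ^ 24 + 44 * C b * X ^ 22 - 422 * C b ^ 2 * X ^ 20 - 2836 * C b ^ 3 * X ^ 18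
    - 5033 * C b ^ 4 * X ^ 16 - 11752 * C b ^ 5 * X ^ 14 - 15988 * C b ^ 6 * X ^ 12
    - 6024 * C b ^ 7 * X ^ 10 + 2239 * C b ^ 8 * X ^ 8 + 2108 * C b ^ 9 * X ^ 6
    + 186 * C b ^ 10 * X ^ 4 + 28 * C b ^ 11 * X ^ 2) - C b ^ 12

section CurveE1

open WeierstrassCurve.Affine WeierstrassCurve.Affine.Point

variable {F : Type*} [Field F] {W : WeierstrassCurve.Affine F} {b : F}

theorem natDegree_curveE1DivisionPolynomialSeven_le :
    (curveE1DivisionPolynomialSeven b).natDegree ≤ 24 := by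
  unfold curveE1DivisionPolynomialSeven
  simp only [← Polynomial.C_pow]
  compute_degree

theorem curveE1DivisionPolynomialSeven_ne_zero (hb : b ≠ 0) :
    curveE1DivisionPolynomialSeven b ≠ 0 := by
  intro h
  have := congr_arg (Polynomial.eval 0) h
  simp [curveE1DivisionPolynomialSeven, hb] at this

theorem curveE1_seven_torsion_mem_roots [DecidableEq F] (hW : W = curveE1 b) (two : (2 : F) ≠ 0)
    (hb : b ≠ 0) {x y : F} (h : W.Nonsingular x y) (h7 : 7 • Point.some x y h = 0) :
    x ∈ (curveE1DivisionPolynomialSeven b).roots := by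
  rw [Polynomial.mem_roots (curveE1DivisionPolynomialSeven_ne_zero hb), Polynomial.IsRoot.def]
  have := curveE1_seven_torsion_eval hW two h h7
  simpa [curveE1DivisionPolynomialSeven] using this

open Classical Polynomial in
/-- A finite set containing the coordinates of all nonzero `7`-torsion points. -/
noncomputable def curveE1SevenTorsionCoords (b : F) : Finset ((_ : F) × F) :=
  (curveE1DivisionPolynomialSeven b).roots.toFinset.sigma fun x ↦
    (X ^ 2 - C (x ^ 3 + b * x)).roots.toFinset

theorem mem_curveE1SevenTorsionCoords_iff (x y : F) :
    ⟨x, y⟩ ∈ curveE1SevenTorsionCoords b ↔ x ∈ (curveE1DivisionPolynomialSeven b).roots ∧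
      y ∈ (Polynomial.X ^ 2 - Polynomial.C (x ^ 3 + b * x)).roots := by
  classical
  rw [curveE1SevenTorsionCoords, Finset.mem_sigma, Multiset.mem_toFinset, Multiset.mem_toFinset]

theorem card_curveE1SevenTorsionCoords_le : (curveE1SevenTorsionCoords b).card ≤ 48 := by
  classical
  rw [curveE1SevenTorsionCoords, Finset.card_sigma]
  refine (Finset.sum_le_card_nsmul _ _ 2 fun x _ ↦ ?_).trans ?_
  · refine (Multiset.toFinset_card_le _).trans ((Polynomial.card_roots' _).trans ?_)
    rw [Polynomial.natDegree_X_pow_sub_C]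
  · have := (Multiset.toFinset_card_le (curveE1DivisionPolynomialSeven b).roots).trans
      ((Polynomial.card_roots' _).trans natDegree_curveE1DivisionPolynomialSeven_le)
    rw [smul_eq_mul]
    lia

theorem curveE1_seven_torsion_mem_coords [DecidableEq F] (hW : W = curveE1 b)
    (two : (2 : F) ≠ 0) (hb : b ≠ 0) {x y : F} (h : W.Nonsingular x y)
    (h7 : 7 • Point.some x y h = 0) : ⟨x, y⟩ ∈ curveE1SevenTorsionCoords b := by
  refine (mem_curveE1SevenTorsionCoords_iff x y).mpr
    ⟨curveE1_seven_torsion_mem_roots hW two hb h h7, ?_⟩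
  rw [Polynomial.mem_roots (Polynomial.X_pow_sub_C_ne_zero two_pos _), Polynomial.IsRoot.def]
  simp [(curveE1_equation_iff hW x y).mp h.1]

theorem curveE1_seven_torsion_finite_card_le [DecidableEq F] (hW : W = curveE1 b)
    (two : (2 : F) ≠ 0) (hb : b ≠ 0) :
    Finite (AddSubgroup.torsionBy W.Point (7 : ℕ)) ∧
      Nat.card (AddSubgroup.torsionBy W.Point (7 : ℕ)) ≤ 49 := by
  have mem (P : AddSubgroup.torsionBy W.Point (7 : ℕ)) : 7 • (P : W.Point) = 0 :=
    AddSubgroup.torsionBy.nsmul_iff.mp P.2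
  let f : AddSubgroup.torsionBy W.Point (7 : ℕ) → Option (curveE1SevenTorsionCoords b) := fun P ↦
    match P with
    | ⟨0, _⟩ => none
    | ⟨.some x y h, hP⟩ => some ⟨⟨x, y⟩, curveE1_seven_torsion_mem_coords hW two hb h (mem ⟨_, hP⟩)⟩
  have hf : Function.Injective f := by
    rintro ⟨_ | ⟨x, y, h⟩, hP⟩ ⟨_ | ⟨x', y', h'⟩, hP'⟩ he
    · rfl
    · cases he
    · cases he
    · cases he
      rfl
  refine ⟨Finite.of_injective f hf, (Nat.card_le_card_of_injective f hf).trans ?_⟩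
  rw [Nat.card_eq_fintype_card, Fintype.card_option, Fintype.card_coe]
  exact Nat.succ_le_succ card_curveE1SevenTorsionCoords_le

end CurveE1

/-! ### Derivations and separability; base change. -/

/-- Derivations L → L are the L-dual of the Kähler differentials, and a vector space with zero dual
is zero. -/
theorem Algebra.FormallyUnramified.of_derivation_eq_zero {K L : Type*} [Field K] [Field L]
    [Algebra K L] (h : ∀ D : Derivation K L L, D = 0) : Algebra.FormallyUnramified K L := by
  refine ⟨subsingleton_of_forall_eq 0 fun ω ↦ (Module.forall_dual_apply_eq_zero_iff L ω).mp
    fun f ↦ ?_⟩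
  have : f = 0 := (KaehlerDifferential.linearMapEquivDerivation K L).injective <| by
    rw [h ((KaehlerDifferential.linearMapEquivDerivation K L) f), _root_.map_zero]
  rw [this, LinearMap.zero_apply]

theorem IntermediateField.derivation_eq_zero_of_adjoin {K E : Type*} [Field K] [Field E]
    [Algebra K E] {S : Set E} (D : Derivation K (IntermediateField.adjoin K S)
      (IntermediateField.adjoin K S))
    (h : ∀ x (hx : x ∈ S), D ⟨x, IntermediateField.subset_adjoin K S hx⟩ = 0) : D = 0 := by
  ext ⟨x, hx⟩
  rw [Derivation.zero_apply]
  refine congr_arg Subtype.val (?_ : D ⟨x, hx⟩ = 0)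
  induction hx using IntermediateField.adjoin_induction with
  | mem x hx => exact h x hx
  | algebraMap x => exact D.map_algebraMap x
  | add x y hx hy h1 h2 =>
    change D (⟨x, hx⟩ + ⟨y, hy⟩) = 0
    rw [map_add, h1, h2, add_zero]
  | inv x hx h1 =>
    change D (⟨x, hx⟩⁻¹) = 0
    rw [Derivation.leibniz_inv, h1, smul_zero]
  | mul x y hx hy h1 h2 =>
    change D (⟨x, hx⟩ * ⟨y, hy⟩) = 0
    rw [Derivation.leibniz, h1, h2, smul_zero, smul_zero, add_zero]

theorem curveE1_baseChange {K A : Type*} [Field K] [Field A] [Algebra K A] (b : K) :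
    (curveE1 b).baseChange A = curveE1 (algebraMap K A b) := by
  simp [WeierstrassCurve.baseChange, WeierstrassCurve.map, curveE1]

theorem ofNat_ne_zero_of_algebra {K : Type*} (A : Type*) [Field K] [Field A] [Algebra K A] {n : ℕ}
    [n.AtLeastTwo] (h : (OfNat.ofNat n : K) ≠ 0) : (OfNat.ofNat n : A) ≠ 0 := by
  rw [← map_ofNat (algebraMap K A)]
  exact (map_ne_zero _).mpr h

/-! ### The 7-division field and the Galois action. -/

section DivisionField

open WeierstrassCurve.Affine WeierstrassCurve.Affine.Point

variable {K : Type*} [Field K] {b : K}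

/-- The affine coordinates of the geometric `7`-torsion points. -/
def sevenTorsionCoordinates [DecidableEq (AlgebraicClosure K)] (b : K) :
    Set (AlgebraicClosure K) :=
  {z | ∃ (x y : AlgebraicClosure K)
    (h : ((curveE1 b).baseChange (AlgebraicClosure K)).toAffine.Nonsingular x y),
      7 • Point.some x y h = 0 ∧ (z = x ∨ z = y)}

open Classical in
theorem divisionField_seven_eq_adjoin (b : K) :
    divisionField (curveE1 b) 7 = IntermediateField.adjoin K (sevenTorsionCoordinates b) :=
  rfl

theorem finite_sevenTorsionCoordinates [DecidableEq (AlgebraicClosure K)] (two : (2 : K) ≠ 0)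
    (hb : b ≠ 0) : (sevenTorsionCoordinates b).Finite := by
  classical
  have two' : (2 : AlgebraicClosure K) ≠ 0 := ofNat_ne_zero_of_algebra _ two
  have hb' := (map_ne_zero (algebraMap K (AlgebraicClosure K))).mpr hb
  let T := curveE1SevenTorsionCoords (algebraMap K (AlgebraicClosure K) b)
  refine ((T.image Sigma.fst) ∪ (T.image Sigma.snd)).finite_toSet.subset ?_
  rintro z ⟨x, y, h, h7, hz⟩
  have hm := curveE1_seven_torsion_mem_coords (curveE1_baseChange b) two' hb' h h7
  rw [Finset.coe_union, Finset.coe_image, Finset.coe_image]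
  exact hz.imp (fun e ↦ ⟨_, hm, e.symm⟩) (fun e ↦ ⟨_, hm, e.symm⟩)

theorem map_mem_sevenTorsionCoordinates [DecidableEq (AlgebraicClosure K)]
    (σ : Gal(AlgebraicClosure K/K)) {z : AlgebraicClosure K}
    (hz : z ∈ sevenTorsionCoordinates b) : σ z ∈ sevenTorsionCoordinates b := by
  obtain ⟨x, y, h, h7, hz⟩ := hz
  have h7' := congr_arg (Point.map (W' := curveE1 b) (σ : AlgebraicClosure K →ₐ[K] AlgebraicClosure K)) h7
  rw [map_nsmul, _root_.map_zero, map_some] at h7'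
  exact ⟨σ x, σ y, _, h7', hz.imp (congr_arg σ) (congr_arg σ)⟩

theorem normal_divisionField_seven (b : K) : Normal K (divisionField (curveE1 b) 7) := by
  classical
  rw [IntermediateField.normal_iff_forall_map_le']
  intro σ
  rw [divisionField_seven_eq_adjoin, IntermediateField.adjoin_map, IntermediateField.adjoin_le_iff]
  rintro _ ⟨z, hz, rfl⟩
  exact IntermediateField.subset_adjoin _ _ (map_mem_sevenTorsionCoordinates σ hz)

theorem finiteDimensional_divisionField_seven (two : (2 : K) ≠ 0) (hb : b ≠ 0) :
    FiniteDimensional K (divisionField (curveE1 b) 7) := by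
  classical
  rw [divisionField_seven_eq_adjoin]
  have := (finite_sevenTorsionCoordinates two hb).to_subtype
  exact IntermediateField.finiteDimensional_adjoin fun x _ ↦ Algebra.IsIntegral.isIntegral x

theorem isSeparable_divisionField_seven (two : (2 : K) ≠ 0) (hb : b ≠ 0) :
    Algebra.IsSeparable K (divisionField (curveE1 b) 7) := by
  classical
  have := finiteDimensional_divisionField_seven two hb
  rw [← Algebra.FormallyUnramified.iff_isSeparable]
  refine .of_derivation_eq_zero fun D ↦ ?_
  refine IntermediateField.derivation_eq_zero_of_adjoin D ?_
  rintro z ⟨x, y, h, h7, hz⟩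
  let L := divisionField (curveE1 b) 7
  by_cases seven : (7 : K) = 0
  · have seven' : (7 : AlgebraicClosure K) = 0 := by
      rw [← map_ofNat (algebraMap K (AlgebraicClosure K)), seven, _root_.map_zero]
    have two' : (2 : AlgebraicClosure K) ≠ 0 := ofNat_ne_zero_of_algebra _ two
    have := curveE1_seven_torsion_eval (curveE1_baseChange b) two' h h7
    rw [seven', zero_mul, zero_sub, neg_eq_zero] at this
    exact absurd (pow_eq_zero_iff (by norm_num) |>.mp this) ((map_ne_zero _).mpr hb)
  · have two' : (2 : L) ≠ 0 := ofNat_ne_zero_of_algebra _ two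
    have seven' : (7 : L) ≠ 0 := ofNat_ne_zero_of_algebra _ seven
    have hx : x ∈ L := IntermediateField.subset_adjoin _ _ ⟨x, y, h, h7, .inl rfl⟩
    have hy : y ∈ L := IntermediateField.subset_adjoin _ _ ⟨x, y, h, h7, .inr rfl⟩
    -- D is defined on L only, so the torsion point is first brought down to L, whose points inject
    -- into those over the algebraic closure.
    have h' : ((curveE1 b).baseChange L).toAffine.Nonsingular ⟨x, hx⟩ ⟨y, hy⟩ :=
      ((curveE1 b).toAffine.baseChange_nonsingular (f := L.val) L.val.injective ⟨x, hx⟩ ⟨y, hy⟩).mp h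
    have h7' : 7 • Point.some (⟨x, hx⟩ : L) ⟨y, hy⟩ h' = 0 := by
      apply map_injective (W' := curveE1 b) L.val
      rw [map_nsmul, map_some, _root_.map_zero]
      exact h7
    obtain ⟨h1, h2⟩ := curveE1_seven_torsion_derivation_eq_zero (curveE1_baseChange b) two' seven'
      D (D.map_algebraMap b) h' h7'
    rcases hz with rfl | rfl
    exacts [h1, h2]

theorem isGalois_divisionField_seven (two : (2 : K) ≠ 0) (hb : b ≠ 0) :
    IsGalois K (divisionField (curveE1 b) 7) where
  to_isSeparable := isSeparable_divisionField_seven two hb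
  to_normal := normal_divisionField_seven b

/-- The action of the absolute automorphism group on the geometric `7`-torsion points. -/
noncomputable def sevenTorsionGaloisAction [DecidableEq (AlgebraicClosure K)] (b : K)
    [Module (ZMod 7) (AddSubgroup.torsionBy
      ((curveE1 b).baseChange (AlgebraicClosure K)).toAffine.Point (7 : ℕ))] :
    Gal(AlgebraicClosure K/K) →* Module.End (ZMod 7) (AddSubgroup.torsionBy
      ((curveE1 b).baseChange (AlgebraicClosure K)).toAffine.Point (7 : ℕ)) where
  toFun σ := AddMonoidHom.toZModLinearMap 7 <|
    ((Point.map (W' := curveE1 b) (σ : AlgebraicClosure K →ₐ[K] AlgebraicClosure K)).comp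
      (AddSubgroup.subtype _)).codRestrict _ fun P ↦ by
        rw [AddSubgroup.torsionBy.nsmul_iff, ← map_nsmul,
          AddSubgroup.torsionBy.nsmul, _root_.map_zero]
  map_one' := by
    ext ⟨P, hP⟩
    rcases P with _ | _ <;> rfl
  map_mul' σ τ := by
    ext ⟨P, hP⟩
    rcases P with _ | _ <;> rfl

/-- A homomorphism from the absolute automorphism group to `Q₁₆ ⋊ ℤ/6` whose kernel fixes exactly
the `7`-division field. -/
theorem exists_hom_ker_eq_fixingSubgroup (two : (2 : K) ≠ 0) (hb : b ≠ 0) :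
    ∃ f : Gal(AlgebraicClosure K/K) →*
        QuaternionGroup 4 ⋊[semilinearAction] Multiplicative (ZMod 6),
      f.ker = (divisionField (curveE1 b) 7).fixingSubgroup := by
  classical
  have two' : (2 : AlgebraicClosure K) ≠ 0 := ofNat_ne_zero_of_algebra _ two
  have hb' := (map_ne_zero (algebraMap K (AlgebraicClosure K))).mpr hb
  obtain ⟨i, hi⟩ := IsAlgClosed.exists_pow_nat_eq (-1 : AlgebraicClosure K) two_pos
  let hW := curveE1_baseChange (A := AlgebraicClosure K) b
  let V := AddSubgroup.torsionBy
    ((curveE1 b).baseChange (AlgebraicClosure K)).toAffine.Point (7 : ℕ)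
  let _ : Module (ZMod 7) V := AddSubgroup.torsionBy.zmodModule
  obtain ⟨hfin, hcard⟩ := curveE1_seven_torsion_finite_card_le hW two' hb'
  let J : Module.End (ZMod 7) V := AddMonoidHom.toZModLinearMap 7 <|
    ((curveE1IMul hW hi).comp (AddSubgroup.subtype _)).codRestrict _ fun P ↦ by
      rw [AddSubgroup.torsionBy.nsmul_iff, ← map_nsmul,
        AddSubgroup.torsionBy.nsmul, _root_.map_zero]
  have hJ : J * J = -1 := by
    ext P
    exact curveE1IMul_curveE1IMul hW hi P
  obtain ⟨f, hf⟩ := exists_hom_semidirectProduct hcard J hJ (sevenTorsionGaloisAction b) (by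
    intro σ
    have hσ : σ i = i ∨ σ i = -i := by
      rw [← sq_eq_sq_iff_eq_or_eq_neg, ← map_pow, hi, map_neg, map_one]
    refine hσ.imp (fun hσ ↦ ?_) (fun hσ ↦ ?_)
    · ext ⟨P, hP⟩
      rcases P with _ | ⟨x, y, h⟩
      · rfl
      · refine (Point.some.injEq ..).mpr ⟨map_neg σ x, ?_⟩
        change σ (i * y) = i * σ y
        rw [map_mul, hσ]
    · ext ⟨P, hP⟩
      rcases P with _ | ⟨x, y, h⟩
      · rfl
      · refine (Point.some.injEq ..).mpr ⟨map_neg σ x, ?_⟩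
        change σ (i * y) = WeierstrassCurve.Affine.negY _ _ (i * σ y)
        rw [map_mul, hσ, curveE1_negY hW, neg_mul])
  refine ⟨f, ?_⟩
  ext σ
  -- Passing to the subgroup generated by σ turns membership in the fixing subgroup, via the Galois
  -- connection, into a condition on the generating coordinates.
  rw [MonoidHom.mem_ker, hf, ← Subgroup.zpowers_le, ← IntermediateField.le_iff_le,
    divisionField_seven_eq_adjoin, IntermediateField.adjoin_le_iff]
  constructor
  · rintro h z ⟨x, y, hxy, h7, hz⟩
    have := congr_arg Subtype.val (LinearMap.congr_fun h
      ⟨Point.some x y hxy, AddSubgroup.torsionBy.nsmul_iff.mpr h7⟩)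
    obtain ⟨h1, h2⟩ := (Point.some.injEq ..).mp this
    have hz : σ z = z := by rcases hz with rfl | rfl; exacts [h1, h2]
    change z ∈ IntermediateField.fixedField _
    rw [IntermediateField.mem_fixedField_iff]
    intro τ hτ
    exact (Subgroup.zpowers_le.mpr (MulAction.mem_stabilizer_iff.mpr hz) hτ :
      τ ∈ MulAction.stabilizer _ z)
  · intro h
    ext ⟨P, hP⟩
    have hfix (z) (hz : z ∈ sevenTorsionCoordinates b) : σ z = z :=
      (IntermediateField.mem_fixedField_iff _ _).mp (h hz) σ (Subgroup.mem_zpowers σ)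
    rcases P with _ | ⟨x, y, hxy⟩
    · rfl
    · have h7 := AddSubgroup.torsionBy.nsmul_iff.mp hP
      exact (Point.some.injEq ..).mpr ⟨hfix x ⟨x, y, hxy, h7, .inl rfl⟩,
        hfix y ⟨x, y, hxy, h7, .inr rfl⟩⟩

end DivisionField

/-! ### From automorphisms of the closure to Gal(K₇/K). -/

/-- Restriction to L is surjective by normality of E, with kernel the fixing subgroup. Separability
of E is not needed, so K may be imperfect. -/
theorem IntermediateField.nonempty_gal_mulEquiv_range {K E T : Type*} [Field K] [Field E]
    [Algebra K E] [Normal K E] [Group T] (L : IntermediateField K E) [Normal K L]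
    (f : Gal(E/K) →* T) (hf : f.ker = L.fixingSubgroup) : Nonempty (Gal(L/K) ≃* f.range) :=
  ⟨(QuotientGroup.quotientKerEquivOfSurjective _
    (AlgEquiv.restrictNormalHom_surjective (F := K) (K₁ := L) E)).symm.trans
      ((QuotientGroup.quotientMulEquivOfEq (L.restrictNormalHom_ker.trans hf.symm)).trans
        (QuotientGroup.quotientKerEquivRange f))⟩

theorem curveE1_ne_zero_of_isElliptic {K : Type*} [Field K] {b : K} (h : (curveE1 b).IsElliptic) :
    b ≠ 0 := by
  rintro rfl
  exact h.isUnit.ne_zero (by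
    simp [curveE1, WeierstrassCurve.Δ, WeierstrassCurve.b₂, WeierstrassCurve.b₄,
      WeierstrassCurve.b₆, WeierstrassCurve.b₈])

theorem theorem3 :
    ∃ φ : Multiplicative (ZMod 6) →* MulAut (QuaternionGroup 4),
      IsEmpty ((QuaternionGroup 4 ⋊[φ] Multiplicative (ZMod 6)) ≃*
        (QuaternionGroup 4 × Multiplicative (ZMod 6))) ∧
      ∀ (K : Type*) [Field K] (b : K),
        ringChar K ≠ 2 → ringChar K ≠ 3 → (curveE1 b).IsElliptic →
          IsGalois K (divisionField (curveE1 b) 7) ∧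
          (∃ H : Subgroup (QuaternionGroup 4 ⋊[φ] Multiplicative (ZMod 6)),
            Nonempty (Gal(divisionField (curveE1 b) 7/K) ≃* H)) ∧
          (Module.finrank K (divisionField (curveE1 b) 7) = 96 →
            Nonempty (Gal(divisionField (curveE1 b) 7/K) ≃*
              (QuaternionGroup 4 ⋊[φ] Multiplicative (ZMod 6)))) := by
  refine ⟨semilinearAction, isEmpty_mulEquiv_prod, fun K _ b h2 _ hell ↦ ?_⟩
  have two : (2 : K) ≠ 0 := Ring.two_ne_zero h2
  have hb := curveE1_ne_zero_of_isElliptic hell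
  have hgal := isGalois_divisionField_seven two hb
  have hfin := finiteDimensional_divisionField_seven two hb
  obtain ⟨f, hf⟩ := exists_hom_ker_eq_fixingSubgroup two hb
  obtain ⟨e⟩ := IntermediateField.nonempty_gal_mulEquiv_range _ f hf
  refine ⟨hgal, ⟨f.range, ⟨e⟩⟩, fun h96 ↦ ?_⟩
  have hcard : Nat.card f.range =
      Nat.card (QuaternionGroup 4 ⋊[semilinearAction] Multiplicative (ZMod 6)) := by
    rw [card_semidirectProduct, ← h96, ← IsGalois.card_aut_eq_finrank, Nat.card_congr e.toEquiv]
  have : Finite (QuaternionGroup 4 ⋊[semilinearAction] Multiplicative (ZMod 6)) :=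
    Nat.finite_of_card_ne_zero (by rw [card_semidirectProduct]; norm_num)
  exact ⟨e.trans ((MulEquiv.subgroupCongr (Subgroup.eq_top_of_card_eq _ hcard)).trans
    Subgroup.topEquiv)⟩
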